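/- **Corollary 5.1 (The Case of Differentiation Operator).** A collection $\{T(t)\}_{t\in J}$ of (possibly unbounded) linear operators in a Banach space $X$ is called *hypercyclic* if there is a nonzero vector $f\in\bigcap_{t\in J}D(T(t))$ whose orbit $\{T(t)f\}_{t\in J}$ is dense in $X$. A linear operator $A:X\supseteq D(A)\to X$ is called *hypercyclic* if there is a nonzero vector $f\in C^\infty(A):=\bigcap_{n=0}^\infty D(A^n)$ whose orbit $\{A^nf\}_{n=0}^{\infty}$ is dense in $X$ (where $A^0=I$ is the identity operator on $X$). In the complex Hilbert space $L_2(\mathbb R)$, the differentiation operator $A:=\dfrac{d}{dx}$ with the domain $$D(A):=W_2^1(\mathbb R):=\{f\in L_2(\mathbb R)\mid f \text{ is absolutely continuous (on every compact interval) with } f'\in L_2(\mathbb R)\}$$ is not hypercyclic. Moreover, the left translations $(T(t)f)(x)=f(x+t)$, $t\in\mathbb R$, form a strongly continuous group of unitary operators on $L_2(\mathbb R)$ with generator $A$ (that is, $D(A)$ is exactly the set of those $f$ for which $\lim_{t\to0}t^{-1}(T(t)f-f)$ exists in $L_2(\mathbb R)$, and $Af$ is this limit), and the group $\{T(t)\}_{t\in\mathbb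 R}$ is not hypercyclic either. -/

import Mathlib

open MeasureTheory Filter Topology

noncomputable section

namespace Hypercyclicity

section General

variable {𝕜 X : Type*} [RCLike 𝕜] [NormedAddCommGroup X] [NormedSpace 𝕜 X]

/-- The composition `B ∘ A` of two (possibly unbounded) linear operators, on its natural domain
`{f ∈ D(A) | A f ∈ D(B)}`. -/
def compose (B A : X →ₗ.[𝕜] X) : X →ₗ.[𝕜] X where
  domain :=
    { carrier := {f | ∃ hf : f ∈ A.domain, A ⟨f, hf⟩ ∈ B.domain}
      zero_mem' := ⟨A.domain.zero_mem, by
        have h : A ⟨0, A.domain.zero_mem⟩ = 0 := A.map_zero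
        rw [h]; exact B.domain.zero_mem⟩
      add_mem' := by
        rintro f g ⟨hf, hf'⟩ ⟨hg, hg'⟩
        refine ⟨A.domain.add_mem hf hg, ?_⟩
        have h : A ⟨f + g, A.domain.add_mem hf hg⟩ = A ⟨f, hf⟩ + A ⟨g, hg⟩ :=
          A.map_add ⟨f, hf⟩ ⟨g, hg⟩
        rw [h]; exact B.domain.add_mem hf' hg'
      smul_mem' := by
        rintro c f ⟨hf, hf'⟩
        refine ⟨A.domain.smul_mem c hf, ?_⟩
        have h : A ⟨c • f, A.domain.smul_mem c hf⟩ = c • A ⟨f, hf⟩ := A.map_smul c ⟨f, hf⟩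
        rw [h]; exact B.domain.smul_mem c hf' }
  toFun :=
    { toFun := fun f => B ⟨A ⟨f.1, f.2.1⟩, f.2.2⟩
      map_add' := by
        rintro ⟨f, hf, hf'⟩ ⟨g, hg, hg'⟩
        rw [← B.map_add]
        congr 1
        exact Subtype.ext (A.map_add ⟨f, hf⟩ ⟨g, hg⟩)
      map_smul' := by
        rintro c ⟨f, hf, hf'⟩
        rw [RingHom.id_apply, ← B.map_smul]
        congr 1
        exact Subtype.ext (A.map_smul c ⟨f, hf⟩) }

/-- The powers of a linear operator: `A⁰ = I` with domain the whole space, and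
`Aⁿ⁺¹ = A ∘ Aⁿ` with domain `{f ∈ D(Aⁿ) | Aⁿ f ∈ D(A)}`. -/
def power (A : X →ₗ.[𝕜] X) : ℕ → (X →ₗ.[𝕜] X)
  | 0 => (LinearMap.id : X →ₗ[𝕜] X).toPMap ⊤
  | n + 1 => compose A (power A n)

/-- A nonzero vector `f ∈ ⋂ₜ D(T(t))` is hypercyclic for the collection `{T(t)}` if its orbit
`{T(t) f}` is dense; the collection is hypercyclic if it possesses such a vector. -/
def IsHypercyclicCollection {J : Type*} (T : J → (X →ₗ.[𝕜] X)) : Prop :=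
  ∃ f : X, f ≠ 0 ∧ ∃ hf : ∀ t, f ∈ (T t).domain, Dense (Set.range fun t => T t ⟨f, hf t⟩)

/-- A linear operator `A` is hypercyclic if there is a nonzero `f ∈ C^∞(A) = ⋂ₙ D(Aⁿ)` whose
orbit `{Aⁿ f}`, `n = 0, 1, 2, …`, is dense. -/
def IsHypercyclic (A : X →ₗ.[𝕜] X) : Prop :=
  IsHypercyclicCollection fun n : ℕ => power A n

/-- `A` is the generator of the one-parameter group `T`: its domain consists of the `f` for which
`lim_{t → 0} (T(t) f - f) / t` exists in norm, and `A f` is that limit. -/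
def IsGenerator (A : X →ₗ.[𝕜] X) (T : ℝ → (X →L[𝕜] X)) : Prop :=
  ∀ f g : X, (∃ hf : f ∈ A.domain, A ⟨f, hf⟩ = g) ↔
    Tendsto (fun t : ℝ => ((t⁻¹ : ℝ) : 𝕜) • (T t f - f)) (𝓝[≠] 0) (𝓝 g)

end General

/-- A strongly continuous one-parameter group of unitary operators on a Hilbert space. -/
structure IsStronglyContinuousUnitaryGroup {H : Type*} [NormedAddCommGroup H]
    [InnerProductSpace ℂ H] [CompleteSpace H] (T : ℝ → (H →L[ℂ] H)) : Prop where
  unitary : ∀ t, T t ∈ unitary (H →L[ℂ] H)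
  zero : T 0 = 1
  add : ∀ s t, T (s + t) = T s * T t
  continuous : ∀ f : H, Continuous fun t => T t f

/-- The complex Hilbert space `L₂(ℝ)`. -/
abbrev L2 : Type := Lp ℂ 2 (volume : Measure ℝ)

/-- `F` is a representative of `f ∈ L₂(ℝ)` that is absolutely continuous on every compact interval
and whose derivative belongs to `L₂(ℝ)`. -/
structure IsW12Rep (f : L2) (F : ℝ → ℂ) : Prop where
  ae_eq : f =ᵐ[volume] F
  absCont : ∀ a b : ℝ, AbsolutelyContinuousOnInterval F a b
  memLp_deriv : MemLp (deriv F) 2 volume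

theorem continuous_of_absCont {F : ℝ → ℂ} (h : ∀ a b : ℝ, AbsolutelyContinuousOnInterval F a b) :
    Continuous F := by
  rw [continuous_iff_continuousAt]
  intro x
  refine (h (x - 1) (x + 1)).continuousOn.continuousAt ?_
  rw [Set.uIcc_of_le (by linarith)]
  exact Icc_mem_nhds (by linarith) (by linarith)

theorem ae_differentiableAt_of_absCont {F : ℝ → ℂ}
    (h : ∀ a b : ℝ, AbsolutelyContinuousOnInterval F a b) :
    ∀ᵐ x, DifferentiableAt ℝ F x := by
  have h1 : ∀ᵐ x, ∀ n : ℕ, x ∈ Set.uIcc (-(n : ℝ)) n → DifferentiableAt ℝ F x := by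
    rw [ae_all_iff]
    intro n
    exact (h _ _).boundedVariationOn.ae_differentiableAt_of_mem_uIcc
  filter_upwards [h1] with x hx
  obtain ⟨n, hn⟩ := exists_nat_ge |x|
  refine hx n ?_
  rw [Set.uIcc_of_le (by linarith [abs_nonneg x])]
  exact abs_le.1 hn

theorem IsW12Rep.unique {f : L2} {F G : ℝ → ℂ} (hF : IsW12Rep f F) (hG : IsW12Rep f G) :
    F = G :=
  Continuous.ae_eq_iff_eq volume (continuous_of_absCont hF.absCont)
    (continuous_of_absCont hG.absCont) |>.1 (hF.ae_eq.symm.trans hG.ae_eq)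

theorem deriv_add_ae {F G : ℝ → ℂ} (hF : ∀ a b : ℝ, AbsolutelyContinuousOnInterval F a b)
    (hG : ∀ a b : ℝ, AbsolutelyContinuousOnInterval G a b) :
    deriv (F + G) =ᵐ[volume] deriv F + deriv G := by
  filter_upwards [ae_differentiableAt_of_absCont hF, ae_differentiableAt_of_absCont hG]
    with x h1 h2
  exact deriv_add h1 h2

theorem deriv_smul_ae {F : ℝ → ℂ} (hF : ∀ a b : ℝ, AbsolutelyContinuousOnInterval F a b) (c : ℂ) :
    deriv (c • F) =ᵐ[volume] c • deriv F := by
  filter_upwards [ae_differentiableAt_of_absCont hF] with x h1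
  exact deriv_const_smul c h1

theorem IsW12Rep.zero : IsW12Rep 0 0 where
  ae_eq := Lp.coeFn_zero ℂ 2 volume
  absCont a b := by
    have h : LipschitzOnWith 0 (0 : ℝ → ℂ) (Set.uIcc a b) := by
      intro x _ y _; simp
    exact h.absolutelyContinuousOnInterval
  memLp_deriv := by
    have h : deriv (0 : ℝ → ℂ) = 0 := deriv_zero
    rw [h]; exact MemLp.zero

theorem IsW12Rep.add {f g : L2} {F G : ℝ → ℂ} (hF : IsW12Rep f F) (hG : IsW12Rep g G) :
    IsW12Rep (f + g) (F + G) where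
  ae_eq := (Lp.coeFn_add f g).trans (hF.ae_eq.add hG.ae_eq)
  absCont a b := (hF.absCont a b).add (hG.absCont a b)
  memLp_deriv := (memLp_congr_ae (deriv_add_ae hF.absCont hG.absCont)).2
    (hF.memLp_deriv.add hG.memLp_deriv)

theorem IsW12Rep.smul {f : L2} {F : ℝ → ℂ} (hF : IsW12Rep f F) (c : ℂ) :
    IsW12Rep (c • f) (c • F) where
  ae_eq := (Lp.coeFn_smul c f).trans (hF.ae_eq.const_smul c)
  absCont a b := (hF.absCont a b).const_smul c
  memLp_deriv := (memLp_congr_ae (deriv_smul_ae hF.absCont c)).2 (hF.memLp_deriv.const_smul c)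

/-- The Sobolev space `W₂¹(ℝ)`, as a subspace of `L₂(ℝ)`: the `f ∈ L₂(ℝ)` that are (after
modification on a null set) absolutely continuous with `f' ∈ L₂(ℝ)`. -/
def W12 : Submodule ℂ L2 where
  carrier := {f | ∃ F, IsW12Rep f F}
  zero_mem' := ⟨0, IsW12Rep.zero⟩
  add_mem' := fun ⟨F, hF⟩ ⟨G, hG⟩ => ⟨F + G, hF.add hG⟩
  smul_mem' := fun c _ ⟨F, hF⟩ => ⟨c • F, hF.smul c⟩

/-- The differentiation operator `d/dx` in `L₂(ℝ)` with domain `W₂¹(ℝ)`. -/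
def diffOp : L2 →ₗ.[ℂ] L2 where
  domain := W12
  toFun :=
    { toFun := fun f => (Classical.choose_spec f.2).memLp_deriv.toLp
      map_add' := by
        intro f g
        have hf := Classical.choose_spec f.2
        have hg := Classical.choose_spec g.2
        have h := (Classical.choose_spec (f + g).2).unique (hf.add hg)
        rw [← MemLp.toLp_add, MemLp.toLp_eq_toLp_iff, h]
        exact deriv_add_ae hf.absCont hg.absCont
      map_smul' := by
        intro c f
        have hf := Classical.choose_spec f.2
        have h := (Classical.choose_spec (c • f).2).unique (hf.smul c)
        rw [RingHom.id_apply, ← MemLp.toLp_const_smul, MemLp.toLp_eq_toLp_iff, h]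
        exact deriv_smul_ae hf.absCont c }

/-- `diffOp` sends `f` to the class of `F'`, for the absolutely continuous representative `F`. -/
theorem diffOp_ae_eq {f : L2} {F : ℝ → ℂ} (hF : IsW12Rep f F) :
    diffOp ⟨f, F, hF⟩ =ᵐ[volume] deriv F := by
  have hf : ∃ F, IsW12Rep f F := ⟨F, hF⟩
  have h := (Classical.choose_spec hf).unique hF
  refine (Classical.choose_spec hf).memLp_deriv.coeFn_toLp.trans ?_
  rw [h]

/-- The left translations `(T(t) f)(x) = f(x + t)` on `L₂(ℝ)`. -/
def leftTranslation (t : ℝ) : L2 →L[ℂ] L2 :=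
  (Lp.compMeasurePreservingₗᵢ ℂ (fun x : ℝ => x + t)
    (measurePreserving_add_right volume t)).toContinuousLinearMap

theorem leftTranslation_ae_eq (t : ℝ) (f : L2) :
    leftTranslation t f =ᵐ[volume] fun x => f (x + t) :=
  Lp.coeFn_compMeasurePreserving f (measurePreserving_add_right volume t)

end Hypercyclicity

end

/-! Orbits of a unitary group lie on spheres, so they are bounded and not dense. The generator `A`
of such a group is skew-symmetric, so ‖Aⁿ⁺¹f‖² = |⟨Aⁿf, Aⁿ⁺²f⟩| ≤ ‖Aⁿf‖ ‖Aⁿ⁺²f‖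
(`norm_power_sq_le`). A sequence with log-convex norms is either nonincreasing in norm, hence
bounded, or strictly increasing in norm from some index on, and then only finitely many terms enter
a suitable ball about 0; neither is dense (`not_dense_range_of_norm_sq_le`). To identify the
generator of the translations, vectors of L₂ are tested against the functionals f ↦ ∫ₐᵇ f. These
separate points and turn translation into a shift of the limits, so the claim reduces to the
fundamental theorem of calculus and Lebesgue differentiation. -/

/-! ### Absolutely continuous vector-valued functions -/

section AbsolutelyContinuous

variable {E : Type*} [NormedAddCommGroup E]

/-- A function whose increments are dominated by those of an absolutely continuous function is
absolutely continuous. -/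
theorem AbsolutelyContinuousOnInterval.of_dist_le {E' : Type*} [NormedAddCommGroup E']
    {F : ℝ → E} {G : ℝ → E'} {a b : ℝ} (hG : AbsolutelyContinuousOnInterval G a b)
    (h : ∀ x y, dist (F x) (F y) ≤ dist (G x) (G y)) :
    AbsolutelyContinuousOnInterval F a b :=
  squeeze_zero (fun _ => Finset.sum_nonneg fun _ _ => dist_nonneg)
    (fun _ => Finset.sum_le_sum fun _ _ => h _ _) hG

variable [NormedSpace ℝ E]

/-- The primitive of a locally interval integrable vector-valued function is absolutely continuous. -/
theorem absolutelyContinuousOnInterval_primitive {f : ℝ → E}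
    (hf : ∀ a b, IntervalIntegrable f volume a b) (c a b : ℝ) :
    AbsolutelyContinuousOnInterval (fun x => ∫ t in c..x, f t) a b := by
  have hn : ∀ a b, IntervalIntegrable (fun t => ‖f t‖) volume a b := fun a b => (hf a b).norm
  have hG : AbsolutelyContinuousOnInterval (fun x => ∫ t in a..x, ‖f t‖) a b :=
    (hn a b).absolutelyContinuousOnInterval_intervalIntegral Set.left_mem_uIcc
  refine hG.of_dist_le fun x y => ?_
  rw [dist_eq_norm, dist_eq_norm, intervalIntegral.integral_interval_sub_left (hf _ _) (hf _ _),
    intervalIntegral.integral_interval_sub_left (hn _ _) (hn _ _)]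
  exact intervalIntegral.norm_integral_le_abs_integral_norm

variable [CompleteSpace E]

/-- The fundamental theorem of calculus for vector-valued absolutely continuous functions that are
differentiable almost everywhere with integrable derivative. -/
theorem integral_deriv_eq_sub_of_absolutelyContinuous {F : ℝ → E}
    (hF : ∀ a b, AbsolutelyContinuousOnInterval F a b) (hd : ∀ᵐ x, DifferentiableAt ℝ F x)
    (hi : LocallyIntegrable (deriv F) volume) (a b : ℝ) :
    ∫ x in a..b, deriv F x = F b - F a := by
  have hint : ∀ a b, IntervalIntegrable (deriv F) volume a b := fun a b =>
    intervalIntegrable_iff.2 <| (hi.integrableOn_isCompact isCompact_uIcc).mono_set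
      Set.uIoc_subset_uIcc
  -- `F` minus the primitive of its derivative is absolutely continuous with derivative zero almost
  -- everywhere, hence constant.
  have hG := (hF a b).sub
    (absolutelyContinuousOnInterval_primitive hint a a b)
  obtain ⟨C, hC⟩ := hG.const_of_ae_hasDerivAt_zero <| by
    filter_upwards [hd, LocallyIntegrable.ae_hasDerivAt_integral hi] with x h1 h2 _
    simpa using h1.hasDerivAt.sub (h2 a)
  have ha := hC a Set.left_mem_uIcc
  have hb := hC b Set.right_mem_uIcc
  simp only [Pi.sub_apply, intervalIntegral.integral_same, sub_zero] at ha hb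
  rw [← ha] at hb
  rw [← hb]; abel

end AbsolutelyContinuous

/-! ### Integrals over intervals and the translation group -/

namespace Hypercyclicity

theorem locallyIntegrable_L2 (f : L2) : LocallyIntegrable f volume :=
  (Lp.memLp f).locallyIntegrable (by norm_num)

theorem intervalIntegrable_L2 (f : L2) (a b : ℝ) : IntervalIntegrable f volume a b :=
  intervalIntegrable_iff.2 <|
    ((locallyIntegrable_L2 f).integrableOn_isCompact isCompact_uIcc).mono_set Set.uIoc_subset_uIcc

/-- The continuous linear functional `f ↦ ∫ x in a..b, f x` on `L₂(ℝ)`. -/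
noncomputable def integralFunctional (a b : ℝ) : L2 →L[ℂ] ℂ :=
  innerSL ℂ (indicatorConstLp 2 (measurableSet_Ioc (a := a) (b := b)) measure_Ioc_lt_top.ne 1) -
  innerSL ℂ (indicatorConstLp 2 (measurableSet_Ioc (a := b) (b := a)) measure_Ioc_lt_top.ne 1)

theorem integralFunctional_apply (a b : ℝ) (f : L2) :
    integralFunctional a b f = ∫ x in a..b, f x := by
  rw [integralFunctional, sub_apply, innerSL_apply_apply,
    innerSL_apply_apply, L2.inner_indicatorConstLp_one, L2.inner_indicatorConstLp_one,
    intervalIntegral]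

/-- The primitives based at 0 coincide, and Lebesgue differentiation recovers each function from its
primitive almost everywhere. -/
theorem L2_ext_of_integral {f g : L2}
    (h : ∀ a b : ℝ, integralFunctional a b f = integralFunctional a b g) : f = g := by
  simp only [integralFunctional_apply] at h
  refine Lp.ext ?_
  filter_upwards [LocallyIntegrable.ae_hasDerivAt_integral (locallyIntegrable_L2 f),
    LocallyIntegrable.ae_hasDerivAt_integral (locallyIntegrable_L2 g)] with x h1 h2
  have h2' := h2 0
  simp only [← h 0] at h2'
  exact (h1 0).unique h2'

theorem integralFunctional_leftTranslation (a b t : ℝ) (f : L2) :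
    integralFunctional a b (leftTranslation t f) = ∫ x in (a + t)..(b + t), f x := by
  rw [integralFunctional_apply, ← intervalIntegral.integral_comp_add_right]
  exact intervalIntegral.integral_congr_ae
    ((leftTranslation_ae_eq t f).mono fun x hx _ => hx)

theorem leftTranslation_zero : leftTranslation 0 = 1 :=
  ContinuousLinearMap.ext fun f => L2_ext_of_integral fun a b => by
    rw [integralFunctional_leftTranslation, integralFunctional_apply, add_zero, add_zero,
      one_apply_eq_self]

theorem leftTranslation_add (s t : ℝ) :
    leftTranslation (s + t) = leftTranslation s * leftTranslation t :=
  ContinuousLinearMap.ext fun f => L2_ext_of_integral fun a b => by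
    have h : integralFunctional (a + s) (b + s) (leftTranslation t f) =
        integralFunctional a b (leftTranslation s (leftTranslation t f)) := by
      rw [integralFunctional_apply, integralFunctional_leftTranslation]
    rw [mul_apply_eq_comp, ← h, integralFunctional_leftTranslation,
      integralFunctional_leftTranslation, add_assoc, add_assoc]

theorem norm_leftTranslation (t : ℝ) (f : L2) : ‖leftTranslation t f‖ = ‖f‖ :=
  LinearIsometry.norm_map _ f

theorem leftTranslation_mem_unitary (t : ℝ) :
    leftTranslation t ∈ unitary (L2 →L[ℂ] L2) := by
  have h1 : leftTranslation t * leftTranslation (-t) = 1 := by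
    rw [← leftTranslation_add, add_neg_cancel, leftTranslation_zero]
  have h2 : leftTranslation (-t) * leftTranslation t = 1 := by
    rw [← leftTranslation_add, neg_add_cancel, leftTranslation_zero]
  -- The isometry property gives T*T = 1; invertibility makes T* a two-sided inverse.
  exact IsUnit.mem_unitary_of_star_mul_self ⟨⟨_, _, h1, h2⟩, rfl⟩ <|
    (leftTranslation t).norm_map_iff_adjoint_comp_self.1 (norm_leftTranslation t)

theorem continuous_leftTranslation (f : L2) : Continuous fun t => leftTranslation t f :=
  Continuous.compMeasurePreservingLp (p := 2) (f := fun _ : ℝ => f)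
    (g := fun t : ℝ => (⟨fun x => x + t, by fun_prop⟩ : C(ℝ, ℝ))) continuous_const
    (ContinuousMap.continuous_of_continuous_uncurry _ (by
      simp only [Function.uncurry_def, ContinuousMap.coe_mk]; fun_prop))
    (measurePreserving_add_right volume) (by norm_num)

theorem isStronglyContinuousUnitaryGroup_leftTranslation :
    IsStronglyContinuousUnitaryGroup leftTranslation where
  unitary := leftTranslation_mem_unitary
  zero := leftTranslation_zero
  add := leftTranslation_add
  continuous := continuous_leftTranslation

/-! ### The generator of the translations -/

/-- The increment of the orbit `t ↦ T(t) f` from zero, integrated over `(a, b]`. -/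
theorem integralFunctional_leftTranslation_sub (a b t : ℝ) (f : L2) :
    integralFunctional a b (leftTranslation t f - f) =
      (∫ x in b..(b + t), f x) - ∫ x in a..(a + t), f x := by
  have hi := intervalIntegrable_L2 f
  rw [map_sub, integralFunctional_leftTranslation, integralFunctional_apply,
    intervalIntegral.integral_interval_sub_interval_comm (hi _ _) (hi _ _) (hi _ _),
    intervalIntegral.integral_symm a (a + t), intervalIntegral.integral_symm b (b + t)]
  ring

/-- Tested over (a, b], the right side becomes the integral of F(b + s) - F(a + s) over s from 0 to
t, which is the tested increment of the orbit. -/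
theorem leftTranslation_sub_eq_integral {f : L2} {F : ℝ → ℂ} (hF : IsW12Rep f F) (t : ℝ) :
    leftTranslation t f - f = ∫ s in (0 : ℝ)..t, leftTranslation s (diffOp ⟨f, F, hF⟩) := by
  refine L2_ext_of_integral fun a b => ?_
  have hFc := continuous_of_absCont hF.absCont
  have hd : ∀ a b : ℝ, ∫ x in a..b, diffOp ⟨f, F, hF⟩ x = F b - F a := fun a b => by
    rw [← integral_deriv_eq_sub_of_absolutelyContinuous hF.absCont
      (ae_differentiableAt_of_absCont hF.absCont)
      (hF.memLp_deriv.locallyIntegrable (by norm_num))]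
    exact intervalIntegral.integral_congr_ae ((diffOp_ae_eq hF).mono fun x hx _ => hx)
  rw [integralFunctional_leftTranslation_sub, ← ContinuousLinearMap.intervalIntegral_comp_comm _
    ((continuous_leftTranslation _).intervalIntegrable _ _)]
  simp only [integralFunctional_leftTranslation, hd]
  rw [intervalIntegral.integral_sub (Continuous.intervalIntegrable (by fun_prop) _ _)
    (Continuous.intervalIntegrable (by fun_prop) _ _)]
  simp only [intervalIntegral.integral_comp_add_left, add_zero]
  congr 1 <;> exact intervalIntegral.integral_congr_ae (hF.ae_eq.mono fun x hx _ => hx)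

theorem tendsto_slope_leftTranslation {f : L2} {F : ℝ → ℂ} (hF : IsW12Rep f F) :
    Tendsto (fun t : ℝ => ((t⁻¹ : ℝ) : ℂ) • (leftTranslation t f - f)) (𝓝[≠] 0)
      (𝓝 (diffOp ⟨f, F, hF⟩)) := by
  have hc := continuous_leftTranslation (diffOp ⟨f, F, hF⟩)
  have h := (intervalIntegral.integral_hasDerivAt_right (hc.intervalIntegrable 0 0)
    (hc.stronglyMeasurableAtFilter _ _) hc.continuousAt).tendsto_slope_zero
  simp only [zero_add, intervalIntegral.integral_same, sub_zero, leftTranslation_zero,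
    one_apply_eq_self, ← leftTranslation_sub_eq_integral hF] at h
  exact h

/-- If the orbit `t ↦ T(t) f` is differentiable at zero with derivative `g`, then `f` has an
absolutely continuous representative, with derivative `g`. -/
theorem exists_isW12Rep_of_tendsto_slope {f g : L2}
    (h : Tendsto (fun t : ℝ => ((t⁻¹ : ℝ) : ℂ) • (leftTranslation t f - f)) (𝓝[≠] 0) (𝓝 g)) :
    ∃ F, IsW12Rep f F ∧ deriv F =ᵐ[volume] g := by
  have hif := intervalIntegrable_L2 f
  have hig := intervalIntegrable_L2 g
  -- A Lebesgue point `a` of `f` fixes the constant of integration in `F`.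
  obtain ⟨a, ha⟩ := (LocallyIntegrable.ae_hasDerivAt_integral (locallyIntegrable_L2 f)).exists
  let F : ℝ → ℂ := fun b => f a + ∫ x in a..b, g x
  -- The difference quotient of the primitive of `f` at `b` is the one at `a` plus the integral over
  -- (a, b] of t⁻¹(T(t)f - f), so it tends to f(a) + ∫ₐᵇ g. Thus the primitive has derivative `F`
  -- everywhere and `f` almost everywhere.
  have hprim : ∀ b, HasDerivAt (fun y => ∫ x in a..y, f x) (F b) b := by
    intro b
    rw [hasDerivAt_iff_tendsto_slope_zero]
    have h1 := (ha a).tendsto_slope_zero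
    have h2 := ((integralFunctional a b).continuous.tendsto g).comp h
    rw [integralFunctional_apply] at h2
    refine (h1.add h2).congr fun t => ?_
    simp only [Function.comp_apply, map_smul, integralFunctional_leftTranslation_sub,
      intervalIntegral.integral_same, sub_zero,
      intervalIntegral.integral_interval_sub_left (hif _ _) (hif _ _), Complex.real_smul,
      smul_eq_mul]
    ring
  have hF : ∀ᵐ x, HasDerivAt F (g x) x :=
    (LocallyIntegrable.ae_hasDerivAt_integral (locallyIntegrable_L2 g)).mono fun x hx => (hx a).const_add (f a)
  have hdF : deriv F =ᵐ[volume] g := hF.mono fun x hx => hx.deriv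
  refine ⟨F, ⟨?_, fun c d => ?_, (memLp_congr_ae hdF).2 (Lp.memLp g)⟩, hdF⟩
  · filter_upwards [LocallyIntegrable.ae_hasDerivAt_integral (locallyIntegrable_L2 f)] with x hx
    exact (hx a).unique (hprim x)
  · refine (absolutelyContinuousOnInterval_primitive
      hig a c d).of_dist_le fun x y => ?_
    simp [F]

theorem isGenerator_diffOp : IsGenerator diffOp leftTranslation := by
  intro f g
  constructor
  · rintro ⟨⟨F, hF⟩, rfl⟩
    exact tendsto_slope_leftTranslation hF
  · intro h
    obtain ⟨F, hF, hg⟩ := exists_isW12Rep_of_tendsto_slope h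
    exact ⟨⟨F, hF⟩, Lp.ext ((diffOp_ae_eq hF).trans hg)⟩

/-! ### Skew-symmetry and log-convexity -/

section Hilbert

variable {H : Type*} [NormedAddCommGroup H] [InnerProductSpace ℂ H]

open scoped InnerProductSpace

/-- The generator of a unitary group is skew-symmetric. -/
theorem IsGenerator.inner_eq_neg [CompleteSpace H] {A : H →ₗ.[ℂ] H} {T : ℝ → (H →L[ℂ] H)}
    (hA : IsGenerator A T) (hT : IsStronglyContinuousUnitaryGroup T) (f g : A.domain) :
    ⟪A f, (g : H)⟫_ℂ = -⟪(f : H), A g⟫_ℂ := by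
  have hf := (hA f (A f)).1 ⟨f.2, rfl⟩
  have hg := (hA g (A g)).1 ⟨g.2, rfl⟩
  -- Since T(t)* = T(-t), the quotient for `f` at t is paired with the one for `g` at -t.
  have hneg : Tendsto (fun t : ℝ => -t) (𝓝[≠] 0) (𝓝[≠] 0) := by
    have h : Tendsto (fun t : ℝ => -t) (𝓝[≠] 0) (𝓝 (-0)) :=
      (continuous_neg.tendsto 0).mono_left nhdsWithin_le_nhds
    rw [neg_zero] at h
    exact tendsto_nhdsWithin_iff.2 ⟨h, eventually_mem_nhdsWithin.mono fun t ht => neg_ne_zero.2 ht⟩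
  have h1 := hf.inner (𝕜 := ℂ) (tendsto_const_nhds (x := (g : H)))
  have h2 := ((tendsto_const_nhds (x := (f : H))).inner (𝕜 := ℂ) (hg.comp hneg)).neg
  refine tendsto_nhds_unique (h1.congr fun t => ?_) h2
  have hadj : ⟪T t f, (g : H)⟫_ℂ = ⟪(f : H), T (-t) g⟫_ℂ := by
    rw [← (T (-t)).inner_map_map_of_mem_unitary (hT.unitary _), ← mul_apply_eq_comp,
      ← hT.add, neg_add_cancel, hT.zero, one_apply_eq_self]
  simp only [Function.comp_apply, inner_smul_left, inner_smul_right, inner_sub_left,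
    inner_sub_right, hadj, RCLike.conj_ofReal, inv_neg, RCLike.ofReal_neg]
  ring

/-- The norms along an orbit of a skew-symmetric operator form a log-convex sequence. -/
theorem norm_power_sq_le {A : H →ₗ.[ℂ] H}
    (hA : ∀ f g : A.domain, ⟪A f, (g : H)⟫_ℂ = -⟪(f : H), A g⟫_ℂ) {f : H}
    (hf : ∀ n, f ∈ (power A n).domain) (n : ℕ) :
    ‖power A (n + 1) ⟨f, hf (n + 1)⟩‖ ^ 2 ≤
      ‖power A n ⟨f, hf n⟩‖ * ‖power A (n + 2) ⟨f, hf (n + 2)⟩‖ := by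
  -- Membership in D(Aⁿ⁺¹) unfolds to Aⁿf ∈ D(A).
  have key := hA ⟨power A n ⟨f, hf n⟩, (hf (n + 1)).2⟩
    ⟨power A (n + 1) ⟨f, hf (n + 1)⟩, (hf (n + 2)).2⟩
  change ⟪power A (n + 1) ⟨f, hf (n + 1)⟩, power A (n + 1) ⟨f, hf (n + 1)⟩⟫_ℂ =
    -⟪power A n ⟨f, hf n⟩, power A (n + 2) ⟨f, hf (n + 2)⟩⟫_ℂ at key
  rw [inner_self_eq_norm_sq_to_K] at key
  have := congrArg norm key
  rw [norm_neg, norm_pow] at this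
  simp only [Complex.coe_algebraMap, Complex.norm_real, norm_norm] at this
  rw [this]
  exact norm_inner_le_norm _ _

end Hilbert

/-! ### Norm obstructions to density -/

section Orbits

variable {X : Type*} [NormedAddCommGroup X] [NormedSpace ℂ X]

/-- A bounded set is not dense in a nontrivial space. -/
theorem not_dense_of_norm_le [Nontrivial X] {s : Set X} {C : ℝ} (h : ∀ x ∈ s, ‖x‖ ≤ C) :
    ¬ Dense s := by
  intro hs
  obtain ⟨x, hx⟩ := NormedSpace.exists_lt_norm ℂ X C
  have : x ∈ Metric.closedBall (0 : X) C :=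
    closure_minimal (fun y hy => by simpa using h y hy) Metric.isClosed_closedBall (hs x)
  exact absurd (by simpa using this) hx.not_ge

/-- A sequence whose norms form a log-convex sequence is not dense. -/
theorem not_dense_range_of_norm_sq_le [Nontrivial X] {u : ℕ → X}
    (h : ∀ n, ‖u (n + 1)‖ ^ 2 ≤ ‖u n‖ * ‖u (n + 2)‖) : ¬ Dense (Set.range u) := by
  by_cases hmono : ∀ n, ‖u (n + 1)‖ ≤ ‖u n‖
  · refine not_dense_of_norm_le (C := ‖u 0‖) ?_
    rintro _ ⟨n, rfl⟩
    exact antitone_nat_of_succ_le (f := fun n => ‖u n‖) hmono n.zero_le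
  · push Not at hmono
    obtain ⟨n, hn⟩ := hmono
    have hstep : ∀ k, ‖u (n + k)‖ < ‖u (n + k + 1)‖ := by
      intro k
      induction k with
      | zero => exact hn
      | succ k ih =>
        -- Otherwise log-convexity gives ‖u (n+k+1)‖² ≤ ‖u (n+k)‖ ‖u (n+k+1)‖, against the strict
        -- growth at the previous step.
        by_contra! hle
        change ‖u (n + k + 2)‖ ≤ ‖u (n + k + 1)‖ at hle
        nlinarith [h (n + k), norm_nonneg (u (n + k)), norm_nonneg (u (n + k + 1))]
    have hinc : ∀ k, ‖u (n + 1)‖ ≤ ‖u (n + 1 + k)‖ := fun k =>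
      monotone_nat_of_le_succ (f := fun k => ‖u (n + 1 + k)‖) (fun k => by
        have := (hstep (k + 1)).le
        convert this using 3 <;> ring) k.zero_le
    intro hd
    -- Without isolated points, density survives the removal of u₀, …, uₙ; yet no later term enters
    -- the open ball of radius ‖u (n+1)‖ > 0.
    have : ∀ x : X, NeBot (𝓝[≠] x) := fun x => Module.punctured_nhds_neBot ℂ X x
    obtain ⟨_, ⟨⟨m, rfl⟩, hm'⟩, hm⟩ := (hd.sdiff_finite
      ((Set.finite_Iic n).image u)).exists_mem_open
      (Metric.isOpen_ball (x := (0 : X)) (ε := ‖u (n + 1)‖))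
      ⟨0, Metric.mem_ball_self ((norm_nonneg _).trans_lt hn)⟩
    rcases le_or_gt m n with hmn | hmn
    · exact hm' ⟨m, hmn, rfl⟩
    · obtain ⟨k, rfl⟩ := Nat.exists_eq_add_of_le (Nat.succ_le_of_lt hmn)
      exact absurd (hinc k) (not_le.2 (by simpa using hm))

end Orbits

/-- The generator of a unitary group is not hypercyclic. -/
theorem IsGenerator.not_isHypercyclic {H : Type*} [NormedAddCommGroup H] [InnerProductSpace ℂ H]
    [CompleteSpace H] {A : H →ₗ.[ℂ] H} {T : ℝ → (H →L[ℂ] H)}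
    (hA : IsGenerator A T) (hT : IsStronglyContinuousUnitaryGroup T) : ¬ IsHypercyclic A := by
  rintro ⟨f, hf0, hf, hd⟩
  have : Nontrivial H := ⟨f, 0, hf0⟩
  exact not_dense_range_of_norm_sq_le (norm_power_sq_le (hA.inner_eq_neg hT) hf) hd

/-- A unitary group is not hypercyclic. -/
theorem IsStronglyContinuousUnitaryGroup.not_isHypercyclicCollection {H : Type*}
    [NormedAddCommGroup H] [InnerProductSpace ℂ H] [CompleteSpace H] {T : ℝ → (H →L[ℂ] H)}
    (hT : IsStronglyContinuousUnitaryGroup T) :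
    ¬ IsHypercyclicCollection (fun t : ℝ => (T t : H →ₗ[ℂ] H).toPMap ⊤) := by
  rintro ⟨f, hf0, hf, hd⟩
  have : Nontrivial H := ⟨f, 0, hf0⟩
  refine not_dense_of_norm_le (C := ‖f‖) ?_ hd
  rintro _ ⟨t, rfl⟩
  exact ((T t).norm_map_of_mem_unitary (hT.unitary t) f).le

end Hypercyclicity

theorem corollary5p1 :
    ¬ Hypercyclicity.IsHypercyclic Hypercyclicity.diffOp ∧
    Hypercyclicity.IsStronglyContinuousUnitaryGroup Hypercyclicity.leftTranslation ∧
    Hypercyclicity.IsGenerator Hypercyclicity.diffOp Hypercyclicity.leftTranslation ∧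
    ¬ Hypercyclicity.IsHypercyclicCollection (fun t : ℝ =>
      (Hypercyclicity.leftTranslation t : Hypercyclicity.L2 →ₗ[ℂ] Hypercyclicity.L2).toPMap ⊤) := by
  have hT := Hypercyclicity.isStronglyContinuousUnitaryGroup_leftTranslation
  have hA := Hypercyclicity.isGenerator_diffOp
  exact ⟨hA.not_isHypercyclic hT, hT, hA, hT.not_isHypercyclicCollection⟩
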